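/- **Setting.** Let $\theta_0\in\mathbb R$, let $r_1,r_2:[\theta_0,\infty)\to(0,\infty)$ be continuous with $r_2(\theta+2\pi)<r_1(\theta)<r_2(\theta)$ for all $\theta\ge\theta_0$, and suppose $\lim_{\theta\to\infty}r_1(\theta)=\lim_{\theta\to\infty}r_2(\theta)=r_*$ for some $r_*>0$. With $X(r,\theta)=(r\cos\theta,r\sin\theta)$ put $$U=\{X(r,\theta):\theta>\theta_0,\ r_1(\theta)<r<r_2(\theta)\},\qquad \widetilde U=\{X(r,\theta):\theta\ge\theta_0,\ r_1(\theta)\le r\le r_2(\theta)\},$$ $$\gamma=\{X(r_i(\theta),\theta):\theta\ge\theta_0,\ i=1,2\},\qquad \mathcal S_\theta=\{X(r,\theta):r_1(\theta)\le r\le r_2(\theta)\}\quad(\theta\ge\theta_0).$$ Let $c_0>0$, $M_1>0$, $M_2\ge0$. For $A=(a_{ij}):U\to\mathbb R^{2\times2}$ and $b:U\to\mathbb R^2$ and $u\in C^2(U)$ write $$Lu=-\sum_{i,j=1}^2a_{ij}\frac{\partial^2u}{\partial x_i\partial x_j}+b\cdot\nabla u .$$ A function $u:\widetilde U\to\mathbb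 R$ is called below exponential growth in $\widetilde U$ if $\lim_{\theta\to\infty}e^{-\varepsilon\theta}\sup_{\mathcal S_\theta}|u|=0$ for every $\varepsilon>0$. **Theorem.** There are constants $C_*>0$, $\nu>0$, $K_1>0$, depending only on $\theta_0,r_1,r_2,c_0,M_1,M_2$, such that the following holds. Suppose that * for every $x\in U$, $A(x)$ is symmetric, $\xi^{\mathrm T}A(x)\xi\ge c_0|\xi|^2$ for all $\xi\in\mathbb R^2$, $\operatorname{Tr}A(x)\le M_1$ and $|b(x)|\le M_2$; * $f_1,f_2:U\to\mathbb R$ are bounded; * $u_1,u_2\in C^2(U)\cap C(\widetilde U)$ satisfy $Lu_1=f_1$ and $Lu_2=f_2$ in $U$, are below exponential growth in $\widetilde U$, and are bounded on $\gamma$. Then, for all $\theta\ge\theta_0$, $$\max_{\mathcal S_\theta}|u_1-u_2|\le(1+C_*)\sup_\gamma|u_1-u_2|+K_1(1+C_*)\sup_U|f_1-f_2|+C_*\Big(\max_{\mathcal S_{\theta_0}}|u_1-u_2|\Big)e^{-\nu(\theta-\theta_0)},$$ and $$\limsup_{\theta\to\infty}\Big(\max_{\mathcal S_\theta}|u_1-u_2|\Big)\le\limsup_{\theta\to\infty}\Big(\sup_{\gamma\cap\mathcal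 S_\theta}|u_1-u_2|\Big)+K_1\limsup_{\theta\to\infty}\Big(\sup_{U\cap\mathcal S_\theta}|f_1-f_2|\Big).$$ -/

import Mathlib

open Filter Topology

noncomputable section

namespace Winding

/-- The Euclidean plane. -/
abbrev Plane : Type := EuclideanSpace ℝ (Fin 2)

/-- Polar coordinates `X(r, θ) = (r cos θ, r sin θ)`. -/
def polar (r θ : ℝ) : Plane := !₂[r * Real.cos θ, r * Real.sin θ]

/-- The winding domain `U = {X(r, θ) : θ > θ₀, r₁(θ) < r < r₂(θ)}`. -/
def domain (θ₀ : ℝ) (r₁ r₂ : ℝ → ℝ) : Set Plane :=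
  {x | ∃ r θ : ℝ, θ₀ < θ ∧ r₁ θ < r ∧ r < r₂ θ ∧ x = polar r θ}

/-- `Ũ = {X(r, θ) : θ ≥ θ₀, r₁(θ) ≤ r ≤ r₂(θ)}`. -/
def domainTilde (θ₀ : ℝ) (r₁ r₂ : ℝ → ℝ) : Set Plane :=
  {x | ∃ r θ : ℝ, θ₀ ≤ θ ∧ r₁ θ ≤ r ∧ r ≤ r₂ θ ∧ x = polar r θ}

/-- The boundary curves `γ = γ₁ ∪ γ₂`, where `γᵢ = {X(rᵢ(θ), θ) : θ ≥ θ₀}`. -/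
def bdryCurves (θ₀ : ℝ) (r₁ r₂ : ℝ → ℝ) : Set Plane :=
  {x | ∃ θ : ℝ, θ₀ ≤ θ ∧ x = polar (r₁ θ) θ} ∪ {x | ∃ θ : ℝ, θ₀ ≤ θ ∧ x = polar (r₂ θ) θ}

/-- The cross-section `S_θ = {X(r, θ) : r₁(θ) ≤ r ≤ r₂(θ)}`. -/
def crossSection (r₁ r₂ : ℝ → ℝ) (θ : ℝ) : Set Plane :=
  {x | ∃ r : ℝ, r₁ θ ≤ r ∧ r ≤ r₂ θ ∧ x = polar r θ}

/-- `sup_{x ∈ S} |g(x)|`. It is used only for non-empty `S` on which `g` is bounded; when `g` is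
continuous and `S` is a cross-section (a compact segment) it is a maximum. -/
def supAbs (S : Set Plane) (g : Plane → ℝ) : ℝ := sSup ((fun x => |g x|) '' S)

/-- The partial derivative `∂u/∂xᵢ`. -/
def pd (i : Fin 2) (u : Plane → ℝ) (x : Plane) : ℝ :=
  fderiv ℝ u x (EuclideanSpace.single i 1)

/-- `Lu = - ∑ aᵢⱼ ∂²u/∂xᵢ∂xⱼ + b · ∇u`. -/
def ellipticOp (A : Plane → Matrix (Fin 2) (Fin 2) ℝ) (b : Plane → Plane) (u : Plane → ℝ)
    (x : Plane) : ℝ :=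
  -(∑ i, ∑ j, A x i j * pd i (pd j u) x) + ∑ i, b x i * pd i u x

/-- On `Ω`, the matrices `A(x)` are symmetric, `ξᵀ A(x) ξ ≥ c₀ |ξ|²` and `Tr A(x) ≤ M₁`. -/
def Elliptic (Ω : Set Plane) (A : Plane → Matrix (Fin 2) (Fin 2) ℝ) (c₀ M₁ : ℝ) : Prop :=
  ∀ x ∈ Ω, (A x).IsSymm ∧ (∀ ξ : Plane, c₀ * ‖ξ‖ ^ 2 ≤ ∑ i, ∑ j, ξ i * A x i j * ξ j) ∧
    (A x).trace ≤ M₁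

/-- `g` is bounded on `S`. -/
def BoundedOn (S : Set Plane) (g : Plane → ℝ) : Prop := ∃ K : ℝ, ∀ x ∈ S, |g x| ≤ K

/-- `u` is below exponential growth in `Ũ`: for every `ε > 0`,
`e^{-εθ} sup_{S_θ} |u| → 0` as `θ → ∞` (note that `S_θ ⊆ Ũ` for `θ ≥ θ₀`). -/
def BelowExpGrowth (r₁ r₂ : ℝ → ℝ) (u : Plane → ℝ) : Prop :=
  ∀ ε : ℝ, 0 < ε →
    Tendsto (fun θ : ℝ => Real.exp (-(ε * θ)) * supAbs (crossSection r₁ r₂ θ) u) atTop (𝓝 0)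

end Winding

end

noncomputable section

namespace Winding


/-! By linearity only `u = u₁ - u₂`, with `Lu = f₁ - f₂`, has to be bounded. The polar angle `Θ` is
multivalued on the plane but is a genuine coordinate along the strip. Each turn lies inside the
previous one, so the strip stays at distance at least `rStar` from the origin and the first two
derivatives of `Θ` are bounded there.

The function `B - e^{l x₀}` is a strict supersolution of `L` once `c₀ l` exceeds `M₂`, since the
strip is bounded. Multiplying it by `e^{sΘ}` with `|s| ≤ ν` adds terms of order `s`; for small `ν`
they consume at most half of the positive margin (`barrier_supersolution`). Three weights are
combined: `s = 0` absorbs the right-hand side, `s = -ν` carries the data on the initial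
cross-section and makes them decay, and `s = ν` with a small factor `η` dominates `u` at the far
end. The last term is a Phragmén–Lindelöf argument: growth below every exponential lets `η` tend to
`0`.

The comparison itself (`comparison`) is the weak maximum principle on a truncated strip `T ≤ θ ≤ N`.
It is run in the `(r, θ)` coordinates, so injectivity of the polar map is never needed; a local
branch of the angle returns to the plane at the minimum point. With `T = θ₀` this gives the first
estimate. With `T` large it gives the second, because the initial data are forgotten exponentially
(`limsup_le_add_of_decay`). -/

/-! ### Calculus of partial derivatives -/

/-- `f` has the partial derivatives `g 0`, `g 1` at `x` (in the Fréchet sense). -/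
def HasPds (f : Plane → ℝ) (g : Fin 2 → ℝ) (x : Plane) : Prop :=
  HasFDerivAt f (∑ i, g i • (EuclideanSpace.proj i : Plane →L[ℝ] ℝ)) x

theorem HasPds.pd_eq {f : Plane → ℝ} {g : Fin 2 → ℝ} {x : Plane} (h : HasPds f g x) (i : Fin 2) :
    pd i f x = g i := by
  unfold pd
  rw [HasFDerivAt.fderiv h]
  fin_cases i <;> simp

theorem fderiv_apply_eq_sum_pd (f : Plane → ℝ) (x ξ : Plane) :
    fderiv ℝ f x ξ = ∑ i, ξ i * pd i f x := by
  have : ξ = ∑ i, ξ i • EuclideanSpace.single i (1 : ℝ) := by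
    ext j; fin_cases j <;> simp
  conv_lhs => rw [this]
  simp [pd]

theorem hasPds_const (c : ℝ) (x : Plane) : HasPds (fun _ => c) (fun _ => 0) x := by
  unfold HasPds
  simpa using hasFDerivAt_const c x

theorem hasPds_coord (j : Fin 2) (x : Plane) :
    HasPds (fun y => y j) (fun i => if i = j then 1 else 0) x := by
  unfold HasPds
  have := (EuclideanSpace.proj j : Plane →L[ℝ] ℝ).hasFDerivAt (x := x)
  simpa using this

theorem HasPds.comp {f : Plane → ℝ} {g : Fin 2 → ℝ} {x : Plane} {φ : ℝ → ℝ} {φ' : ℝ}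
    (hφ : HasDerivAt φ φ' (f x)) (h : HasPds f g x) :
    HasPds (fun y => φ (f y)) (fun i => φ' * g i) x := by
  have := hφ.comp_hasFDerivAt x h
  unfold HasPds
  simpa [Finset.smul_sum, smul_smul, Function.comp_def] using this

theorem HasPds.add {f f' : Plane → ℝ} {g g' : Fin 2 → ℝ} {x : Plane} (h : HasPds f g x)
    (h' : HasPds f' g' x) : HasPds (fun y => f y + f' y) (fun i => g i + g' i) x := by
  have := HasFDerivAt.fun_add h h'
  unfold HasPds
  simpa [add_smul, Finset.sum_add_distrib] using this

theorem HasPds.mul {f f' : Plane → ℝ} {g g' : Fin 2 → ℝ} {x : Plane} (h : HasPds f g x)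
    (h' : HasPds f' g' x) :
    HasPds (fun y => f y * f' y) (fun i => f x * g' i + f' x * g i) x := by
  have := HasFDerivAt.fun_mul h h'
  unfold HasPds
  simpa [add_smul, Finset.sum_add_distrib, Finset.smul_sum, smul_smul] using this

theorem HasPds.const_mul {f : Plane → ℝ} {g : Fin 2 → ℝ} {x : Plane} (c : ℝ) (h : HasPds f g x) :
    HasPds (fun y => c * f y) (fun i => c * g i) x := by
  simpa using (hasPds_const c x).mul h

theorem HasPds.div {f f' : Plane → ℝ} {g g' : Fin 2 → ℝ} {x : Plane} (h : HasPds f g x)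
    (h' : HasPds f' g' x) (hx : f' x ≠ 0) :
    HasPds (fun y => f y / f' y) (fun i => (g i * f' x - f x * g' i) / f' x ^ 2) x := by
  have h2 := h.mul (h'.comp (hasDerivAt_inv hx))
  simp only [div_eq_mul_inv]
  convert h2 using 2
  field_simp
  ring

theorem HasPds.congr {f : Plane → ℝ} {g g' : Fin 2 → ℝ} {x : Plane} (h : HasPds f g x)
    (e : ∀ i, g i = g' i) : HasPds f g' x := by
  rwa [← funext e]

theorem contDiffAt_pd {w : Plane → ℝ} {x : Plane} (hw : ContDiffAt ℝ 2 w x) (j : Fin 2) :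
    ContDiffAt ℝ 1 (pd j w) x := by
  have : ContDiffAt ℝ 1 (fderiv ℝ w) x := hw.fderiv_right (by norm_num)
  exact this.clm_apply contDiffAt_const

theorem eventually_differentiableAt {w : Plane → ℝ} {x : Plane} (hw : ContDiffAt ℝ 2 w x) :
    ∀ᶠ y in 𝓝 x, DifferentiableAt ℝ w y := by
  filter_upwards [hw.eventually (by simp)] with y hy
  exact hy.differentiableAt (by norm_num)

theorem ellipticOp_linear (A : Plane → Matrix (Fin 2) (Fin 2) ℝ) (b : Plane → Plane)
    {v w : Plane → ℝ} {x : Plane} (hv : ContDiffAt ℝ 2 v x) (hw : ContDiffAt ℝ 2 w x) (c : ℝ) :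
    ellipticOp A b (fun y => v y + c * w y) x = ellipticOp A b v x + c * ellipticOp A b w x := by
  have h1 : ∀ j, ∀ {v w : Plane → ℝ} {y : Plane}, DifferentiableAt ℝ v y → DifferentiableAt ℝ w y →
      pd j (fun y => v y + c * w y) y = pd j v y + c * pd j w y := by
    intro j v w y hv hw
    unfold pd
    rw [fderiv_fun_add hv (hw.const_mul c), fderiv_const_mul hw]
    simp
  have h2 : ∀ j, pd j (fun y => v y + c * w y) =ᶠ[𝓝 x] fun y => pd j v y + c * pd j w y := by
    intro j
    filter_upwards [eventually_differentiableAt hv, eventually_differentiableAt hw] with y a b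
    exact h1 j a b
  have h3 : ∀ i j, pd i (pd j (fun y => v y + c * w y)) x
      = pd i (pd j v) x + c * pd i (pd j w) x := by
    intro i j
    rw [← h1 i ((contDiffAt_pd hv j).differentiableAt (by norm_num))
      ((contDiffAt_pd hw j).differentiableAt (by norm_num))]
    simp only [pd]
    rw [Filter.EventuallyEq.fderiv_eq (h2 j)]
    rfl
  unfold ellipticOp
  simp only [h3, fun j => (h2 j).eq_of_nhds, Fin.sum_univ_two]
  ring

/-! ### Weak minimum principle for the elliptic operator -/

/-- If `c < 0`, the second derivative test makes `0` a local maximum too, so `g` is locally constant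
and `c = 0`. -/
theorem IsLocalMin.second_deriv_nonneg {g : ℝ → ℝ} (hmin : IsLocalMin g 0) {c : ℝ} {g' : ℝ → ℝ}
    (h1 : ∀ᶠ t in 𝓝 0, HasDerivAt g (g' t) t) (h2 : HasDerivAt g' c 0) : 0 ≤ c := by
  by_contra! hc
  have hd : deriv g =ᶠ[𝓝 0] g' := h1.mono fun t ht => ht.deriv
  have hdd : deriv (deriv g) 0 = c := by rw [hd.deriv_eq, h2.deriv]
  have hmax : IsLocalMax g 0 := isLocalMax_of_deriv_deriv_neg (by rw [hdd]; exact hc)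
    hmin.deriv_eq_zero h1.self_of_nhds.continuousAt
  have hcst : g =ᶠ[𝓝 0] fun _ => g 0 := by
    filter_upwards [hmin, hmax] with t a b using le_antisymm b a
  have h0 : deriv g =ᶠ[𝓝 0] fun _ => 0 := by
    refine hcst.deriv.trans ?_
    simp
  rw [h0.deriv_eq] at hdd
  simp at hdd
  exact hc.ne hdd.symm

theorem hessian_nonneg_of_isLocalMin {w : Plane → ℝ} {x : Plane} (hw : ContDiffAt ℝ 2 w x)
    (hmin : IsLocalMin w x) (ξ : Plane) :
    0 ≤ ∑ j, ξ j * ∑ i, ξ i * pd i (pd j w) x := by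
  have hline : ∀ t : ℝ, HasDerivAt (fun t : ℝ => x + t • ξ) ξ t := by
    intro t
    simpa using ((hasDerivAt_id t).smul_const ξ).const_add x
  have htend : Tendsto (fun t : ℝ => x + t • ξ) (𝓝 0) (𝓝 x) := by
    simpa using (hline 0).continuousAt.tendsto
  refine IsLocalMin.second_deriv_nonneg (g := fun t : ℝ => w (x + t • ξ))
    (g' := fun t => ∑ j, ξ j * pd j w (x + t • ξ)) ?_ ?_ ?_
  · have := htend.eventually hmin
    simpa [IsLocalMin, IsMinFilter] using this
  · filter_upwards [htend.eventually (eventually_differentiableAt hw)] with t ht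
    rw [← fderiv_apply_eq_sum_pd]
    exact ht.hasFDerivAt.comp_hasDerivAt t (hline t)
  · refine HasDerivAt.fun_sum fun j _ => HasDerivAt.const_mul _ ?_
    rw [← fderiv_apply_eq_sum_pd]
    have hd : DifferentiableAt ℝ (pd j w) (x + (0 : ℝ) • ξ) := by
      simpa using (contDiffAt_pd hw j).differentiableAt (by norm_num)
    simpa [Function.comp_def] using hd.hasFDerivAt.comp_hasDerivAt 0 (hline 0)

/-- Multiplied by `a`, the trace is the quadratic form at `(a, b)` plus `(a d - b²) s`. Symmetry of
the Hessian, `q = q'`, is not needed. -/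
theorem trace_mul_nonneg {a b d p q q' s : ℝ} (ha : 0 < a) (hdet : 0 ≤ a * d - b ^ 2)
    (h : ∀ x y : ℝ, 0 ≤ x * (x * p + y * q') + y * (x * q + y * s)) :
    0 ≤ a * p + b * q + (b * q' + d * s) := by
  have h1 := h a b
  have h2 := h 0 1
  simp at h2
  refine nonneg_of_mul_nonneg_right (a := a) ?_ ha
  nlinarith [mul_nonneg hdet h2]

/-- Bounds on the entries of the coefficient matrix. -/
theorem Elliptic.entries {Ω : Set Plane} {A : Plane → Matrix (Fin 2) (Fin 2) ℝ} {c₀ M₁ : ℝ}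
    (hA : Elliptic Ω A c₀ M₁) (hc₀ : 0 < c₀) {x : Plane} (hx : x ∈ Ω) :
    A x 1 0 = A x 0 1 ∧ c₀ ≤ A x 0 0 ∧ 0 ≤ A x 0 0 * A x 1 1 - A x 0 1 ^ 2 ∧
      ∀ i j, |A x i j| ≤ M₁ := by
  obtain ⟨hs, he, ht⟩ := hA x hx
  have hsym : A x 1 0 = A x 0 1 := hs.apply 0 1
  have hq : ∀ p q : ℝ, c₀ * (p ^ 2 + q ^ 2) ≤
      p ^ 2 * A x 0 0 + 2 * (p * q) * A x 0 1 + q ^ 2 * A x 1 1 := by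
    intro p q
    have := he !₂[p, q]
    simp [EuclideanSpace.norm_sq_eq, Fin.sum_univ_two, hsym] at this
    linarith
  have h0 := hq 1 0
  have h1 := hq 0 1
  have hdet : 0 ≤ A x 0 0 * A x 1 1 - A x 0 1 ^ 2 := by
    -- At this test vector the quadratic form equals `a₀₀ (a₀₀ a₁₁ - a₀₁²)`.
    have h := hq (A x 0 1) (-A x 0 0)
    have h3 : 0 ≤ A x 0 0 * (A x 0 0 * A x 1 1 - A x 0 1 ^ 2) := by nlinarith [sq_nonneg (A x 0 1), sq_nonneg (A x 0 0)]
    exact nonneg_of_mul_nonneg_right h3 (by linarith)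
  have htr : A x 0 0 + A x 1 1 ≤ M₁ := by simpa [Matrix.trace, Fin.sum_univ_two] using ht
  refine ⟨hsym, by linarith, hdet, ?_⟩
  have h01 : |A x 0 1| ≤ M₁ := abs_le_of_sq_le_sq (by nlinarith) (by linarith)
  intro i j
  fin_cases i <;> fin_cases j
  · exact abs_le.2 ⟨by dsimp; linarith, by dsimp; linarith⟩
  · exact h01
  · simpa [hsym] using h01
  · exact abs_le.2 ⟨by dsimp; linarith, by dsimp; linarith⟩

theorem ellipticOp_nonpos_of_isLocalMin {Ω : Set Plane} {A : Plane → Matrix (Fin 2) (Fin 2) ℝ}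
    {c₀ M₁ : ℝ} (hA : Elliptic Ω A c₀ M₁) (hc₀ : 0 < c₀) (b : Plane → Plane)
    {x : Plane} (hx : x ∈ Ω) {w : Plane → ℝ} (hw : ContDiffAt ℝ 2 w x) (hmin : IsLocalMin w x) :
    ellipticOp A b w x ≤ 0 := by
  obtain ⟨hsym, h0, hdet, -⟩ := hA.entries hc₀ hx
  have hg : ∀ i, pd i w x = 0 := fun i => by simp [pd, hmin.fderiv_eq_zero]
  have := trace_mul_nonneg (hc₀.trans_le h0) hdet (p := pd 0 (pd 0 w) x) (q := pd 0 (pd 1 w) x)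
    (q' := pd 1 (pd 0 w) x) (s := pd 1 (pd 1 w) x) fun p q => by
      simpa [Fin.sum_univ_two] using hessian_nonneg_of_isLocalMin hw hmin !₂[p, q]
  simp only [ellipticOp, hg, Fin.sum_univ_two, hsym]
  linarith


/-! ### Polar coordinates and local branches of the angle -/

theorem norm_sq_plane (x : Plane) : ‖x‖ ^ 2 = x 0 ^ 2 + x 1 ^ 2 := by
  simp [EuclideanSpace.norm_sq_eq, Fin.sum_univ_two]

theorem norm_polar {r : ℝ} (hr : 0 ≤ r) (θ : ℝ) : ‖polar r θ‖ = r := by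
  have h : ‖polar r θ‖ ^ 2 = r ^ 2 := by
    rw [norm_sq_plane]
    simp only [polar, PiLp.toLp_apply, Matrix.cons_val_zero, Matrix.cons_val_one]
    linear_combination r ^ 2 * Real.sin_sq_add_cos_sq θ
  exact (sq_eq_sq₀ (norm_nonneg _) hr).1 h

theorem abs_coord_le_norm (x : Plane) (i : Fin 2) : |x i| ≤ ‖x‖ := by
  refine abs_le_of_sq_le_sq ?_ (norm_nonneg _)
  rw [norm_sq_plane]
  fin_cases i <;> simp [sq_nonneg]

/-- The first coordinate of `x` in the frame rotated by `α`. -/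
def rotFst (α : ℝ) (x : Plane) : ℝ := Real.cos α * x 0 + Real.sin α * x 1

/-- The second coordinate of `x` in the frame rotated by `α`. -/
def rotSnd (α : ℝ) (x : Plane) : ℝ := Real.cos α * x 1 + -Real.sin α * x 0

/-- The branch of the polar angle with values in `(α - π/2, α + π/2)`. -/
def angle (α : ℝ) (x : Plane) : ℝ := α + Real.arctan (rotSnd α x / rotFst α x)

theorem rotFst_sq_add (α : ℝ) (x : Plane) : rotFst α x ^ 2 + rotSnd α x ^ 2 = x 0 ^ 2 + x 1 ^ 2 := by
  unfold rotFst rotSnd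
  linear_combination (x 0 ^ 2 + x 1 ^ 2) * Real.sin_sq_add_cos_sq α

theorem rotFst_polar (r α : ℝ) : rotFst α (polar r α) = r := by
  simp only [rotFst, polar, PiLp.toLp_apply, Matrix.cons_val_zero, Matrix.cons_val_one]
  linear_combination r * Real.sin_sq_add_cos_sq α

theorem angle_polar (r α : ℝ) : angle α (polar r α) = α := by
  have : rotSnd α (polar r α) = 0 := by
    simp only [rotSnd, polar, PiLp.toLp_apply, Matrix.cons_val_zero, Matrix.cons_val_one]
    ring
  simp [angle, this]

/-- On the half-plane `rotFst α > 0`, `(‖x‖, angle α x)` is a right inverse of the polar map; this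
transfers local statements between the strip and the plane. -/
theorem polar_norm_angle {α : ℝ} {x : Plane} (hx : 0 < rotFst α x) :
    polar ‖x‖ (angle α x) = x := by
  set p := rotFst α x with hp
  set q := rotSnd α x with hq
  have hn : ‖x‖ ^ 2 = p ^ 2 + q ^ 2 := by rw [norm_sq_plane, rotFst_sq_add]
  have hn0 : 0 < ‖x‖ := by
    by_contra! h
    have : ‖x‖ = 0 := le_antisymm h (norm_nonneg _)
    rw [this] at hn
    nlinarith [sq_nonneg q]
  have hs : √(1 + (q / p) ^ 2) = ‖x‖ / p := by
    rw [Real.sqrt_eq_iff_mul_self_eq (by positivity) (by positivity), ← sq, div_pow, div_pow, hn]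
    field_simp
  have hc : ‖x‖ * Real.cos (Real.arctan (q / p)) = p := by
    rw [Real.cos_arctan, hs]; field_simp
  have hsn : ‖x‖ * Real.sin (Real.arctan (q / p)) = q := by
    rw [Real.sin_arctan, hs]; field_simp
  ext i
  fin_cases i
  · simp only [polar, angle, PiLp.toLp_apply, Matrix.cons_val_zero, Fin.zero_eta, Real.cos_add,
      ← hp, ← hq]
    have : ‖x‖ * (Real.cos α * Real.cos (Real.arctan (q / p))
        - Real.sin α * Real.sin (Real.arctan (q / p))) = Real.cos α * p - Real.sin α * q := by
      linear_combination Real.cos α * hc - Real.sin α * hsn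
    rw [this, hp, hq, rotFst, rotSnd]
    linear_combination x 0 * Real.sin_sq_add_cos_sq α
  · simp only [polar, angle, PiLp.toLp_apply, Matrix.cons_val_one, Matrix.cons_val_fin_one, Fin.mk_one, Real.sin_add,
      ← hp, ← hq]
    have : ‖x‖ * (Real.sin α * Real.cos (Real.arctan (q / p))
        + Real.cos α * Real.sin (Real.arctan (q / p))) = Real.sin α * p + Real.cos α * q := by
      linear_combination Real.sin α * hc + Real.cos α * hsn
    rw [this, hp, hq, rotFst, rotSnd]
    linear_combination x 1 * Real.sin_sq_add_cos_sq α

theorem contDiff_coord {n : WithTop ℕ∞} (i : Fin 2) : ContDiff ℝ n fun x : Plane => x i :=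
  (EuclideanSpace.proj i : Plane →L[ℝ] ℝ).contDiff

theorem contDiff_rotFst {n : WithTop ℕ∞} (α : ℝ) : ContDiff ℝ n (rotFst α) :=
  (contDiff_const.mul (contDiff_coord 0)).add (contDiff_const.mul (contDiff_coord 1))

theorem contDiff_rotSnd {n : WithTop ℕ∞} (α : ℝ) : ContDiff ℝ n (rotSnd α) :=
  (contDiff_const.mul (contDiff_coord 1)).add (contDiff_const.mul (contDiff_coord 0))

theorem contDiffAt_angle {n : WithTop ℕ∞} {α : ℝ} {x : Plane} (hx : 0 < rotFst α x) :
    ContDiffAt ℝ n (angle α) x :=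
  contDiffAt_const.add (Real.contDiff_arctan.contDiffAt.comp x
    ((contDiff_rotSnd α).contDiffAt.div (contDiff_rotFst α).contDiffAt hx.ne'))

theorem eventually_rotFst_pos {α : ℝ} {x : Plane} (hx : 0 < rotFst α x) :
    ∀ᶠ y in 𝓝 x, 0 < rotFst α y :=
  (contDiff_rotFst (n := 0) α).continuous.continuousAt.eventually (lt_mem_nhds hx)

/-- The gradient of the polar angle. -/
def angleGrad (j : Fin 2) (x : Plane) : ℝ :=
  (![-1, 1] j * x (1 - j)) / (x 0 * x 0 + x 1 * x 1)

/-- The Hessian of the polar angle. -/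
def angleHess (j i : Fin 2) (x : Plane) : ℝ :=
  (![![2 * x 0 * x 1, x 1 ^ 2 - x 0 ^ 2], ![x 1 ^ 2 - x 0 ^ 2, -(2 * x 0 * x 1)]] j i)
    / (x 0 * x 0 + x 1 * x 1) ^ 2

theorem hasPds_angle {α : ℝ} {x : Plane} (hx : 0 < rotFst α x) :
    HasPds (angle α) (fun j => angleGrad j x) x := by
  have hp : HasPds (rotFst α) _ x :=
    ((hasPds_coord 0 x).const_mul (Real.cos α)).add ((hasPds_coord 1 x).const_mul (Real.sin α))
  have hq : HasPds (rotSnd α) _ x :=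
    ((hasPds_coord 1 x).const_mul (Real.cos α)).add ((hasPds_coord 0 x).const_mul (-Real.sin α))
  have h := (hasPds_const α x).add
    ((hq.div hp hx.ne').comp (Real.hasDerivAt_arctan (rotSnd α x / rotFst α x)))
  refine h.congr fun i => ?_
  have hs := rotFst_sq_add α x
  have hpos : 0 < rotFst α x ^ 2 + rotSnd α x ^ 2 := by positivity
  have hone : 1 + (rotSnd α x / rotFst α x) ^ 2
      = (rotFst α x ^ 2 + rotSnd α x ^ 2) / rotFst α x ^ 2 := by field_simp
  have hxx : x 0 * x 0 + x 1 * x 1 = rotFst α x ^ 2 + rotSnd α x ^ 2 := by rw [hs]; ring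
  rw [hone, angleGrad, hxx]
  fin_cases i
  · have : -Real.sin α * rotFst α x - rotSnd α x * Real.cos α = - x 1 := by
      rw [rotFst, rotSnd]; linear_combination -x 1 * Real.sin_sq_add_cos_sq α
    simp
    field_simp
    linear_combination this
  · have : Real.cos α * rotFst α x - rotSnd α x * Real.sin α = x 0 := by
      rw [rotFst, rotSnd]; linear_combination x 0 * Real.sin_sq_add_cos_sq α
    simp
    field_simp
    linear_combination this

theorem hasPds_angleGrad {x : Plane} (hx : 0 < ‖x‖) (j : Fin 2) :
    HasPds (angleGrad j) (fun i => angleHess j i x) x := by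
  have hx' : 0 < x 0 * x 0 + x 1 * x 1 := by nlinarith [norm_sq_plane x]
  have h := ((hasPds_coord (1 - j) x).const_mul (![-1, 1] j)).div
    (((hasPds_coord 0 x).mul (hasPds_coord 0 x)).add ((hasPds_coord 1 x).mul (hasPds_coord 1 x)))
    hx'.ne'
  refine h.congr fun i => ?_
  rw [angleHess]
  fin_cases i <;> fin_cases j <;> simp <;> ring

theorem abs_angleGrad_le {ρ : ℝ} (hρ : 0 < ρ) {x : Plane} (hx : ρ ≤ ‖x‖) (j : Fin 2) :
    |angleGrad j x| ≤ 1 / ρ := by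
  have h0 : 0 < ‖x‖ := hρ.trans_le hx
  have h2 : x 0 * x 0 + x 1 * x 1 = ‖x‖ ^ 2 := by rw [norm_sq_plane]; ring
  have h1 : |![-1, 1] j * x (1 - j)| ≤ ‖x‖ := by
    fin_cases j
    · simpa using abs_coord_le_norm x 1
    · simpa using abs_coord_le_norm x 0
  rw [angleGrad, h2, abs_div, abs_of_pos (by positivity : 0 < ‖x‖ ^ 2)]
  calc _ ≤ ‖x‖ / ‖x‖ ^ 2 := by gcongr
    _ = 1 / ‖x‖ := by field_simp
    _ ≤ _ := by gcongr

theorem abs_angleHess_le {ρ : ℝ} (hρ : 0 < ρ) {x : Plane} (hx : ρ ≤ ‖x‖) (j i : Fin 2) :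
    |angleHess j i x| ≤ 1 / ρ ^ 2 := by
  have h0 : 0 < ‖x‖ := hρ.trans_le hx
  have h3 := norm_sq_plane x
  have h2 : x 0 * x 0 + x 1 * x 1 = ‖x‖ ^ 2 := by rw [h3]; ring
  have h1 : |![![2 * x 0 * x 1, x 1 ^ 2 - x 0 ^ 2], ![x 1 ^ 2 - x 0 ^ 2, -(2 * x 0 * x 1)]] j i|
      ≤ ‖x‖ ^ 2 := by
    rw [h3, abs_le]
    fin_cases j <;> fin_cases i <;> simp <;> constructor <;>
      nlinarith [sq_nonneg (x 0 - x 1), sq_nonneg (x 0 + x 1), sq_nonneg (x 0), sq_nonneg (x 1)]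
  rw [angleHess, h2, abs_div, abs_of_pos (by positivity : 0 < (‖x‖ ^ 2) ^ 2)]
  calc _ ≤ ‖x‖ ^ 2 / (‖x‖ ^ 2) ^ 2 := by gcongr
    _ = 1 / ‖x‖ ^ 2 := by field_simp
    _ ≤ _ := by gcongr

/-! ### The barrier and its supersolution property -/

/-- The barrier `e^{sΘ} (B - e^{l x₀})`, where `Θ` is the polar angle. -/
def barrier (α l B s : ℝ) (x : Plane) : ℝ :=
  Real.exp (s * angle α x) * (B + -1 * Real.exp (l * x 0))

theorem contDiffAt_barrier {n : WithTop ℕ∞} {α : ℝ} (l B s : ℝ) {x : Plane}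
    (hx : 0 < rotFst α x) : ContDiffAt ℝ n (barrier α l B s) x := by
  have h1 := (contDiffAt_const (c := s)).mul (contDiffAt_angle (n := n) hx)
  have h2 := (contDiff_const (c := l)).mul (contDiff_coord (n := n) 0)
  exact h1.exp.mul (contDiffAt_const.add (contDiffAt_const.mul h2.exp.contDiffAt))

theorem hasPds_exp_coord (l : ℝ) (x : Plane) : HasPds (fun y => Real.exp (l * y 0))
    (fun i => Real.exp (l * x 0) * (l * if i = 0 then 1 else 0)) x :=
  ((hasPds_coord 0 x).const_mul l).comp (Real.hasDerivAt_exp _)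

theorem hasPds_exp_angle {α : ℝ} (s : ℝ) {x : Plane} (hx : 0 < rotFst α x) :
    HasPds (fun y => Real.exp (s * angle α y))
      (fun i => Real.exp (s * angle α x) * (s * angleGrad i x)) x :=
  ((hasPds_angle hx).const_mul s).comp (Real.hasDerivAt_exp _)

theorem pd_barrier {α : ℝ} (l B s : ℝ) {x : Plane} (hx : 0 < rotFst α x) (j : Fin 2) :
    pd j (barrier α l B s) x = Real.exp (s * angle α x) *
      (s * (angleGrad j x * (B + -1 * Real.exp (l * x 0))) +
        -(l * if j = 0 then 1 else 0) * Real.exp (l * x 0)) := by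
  have h : HasPds (barrier α l B s) _ x := (hasPds_exp_angle s hx).mul
    ((hasPds_const B x).add ((hasPds_exp_coord l x).const_mul (-1)))
  rw [h.pd_eq j]
  ring

theorem pd_pd_barrier {α : ℝ} (l B s : ℝ) {x : Plane} (hx : 0 < rotFst α x) (i j : Fin 2) :
    pd i (pd j (barrier α l B s)) x = Real.exp (s * angle α x) *
      (s * (s * angleGrad i x * angleGrad j x * (B + -1 * Real.exp (l * x 0))
        + angleHess j i x * (B + -1 * Real.exp (l * x 0))
        - angleGrad j x * (l * (if i = 0 then 1 else 0) * Real.exp (l * x 0))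
        - angleGrad i x * (l * (if j = 0 then 1 else 0) * Real.exp (l * x 0)))
        - (l * if i = 0 then 1 else 0) * (l * if j = 0 then 1 else 0) * Real.exp (l * x 0)) := by
  have hn : 0 < ‖x‖ := by
    refine norm_pos_iff.2 fun h => ?_
    simp [h, rotFst] at hx
  have he : pd j (barrier α l B s) =ᶠ[𝓝 x] fun x => Real.exp (s * angle α x) *
      (s * (angleGrad j x * (B + -1 * Real.exp (l * x 0))) +
        -(l * if j = 0 then 1 else 0) * Real.exp (l * x 0)) := by
    filter_upwards [eventually_rotFst_pos hx] with y hy using pd_barrier l B s hy j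
  have h := (hasPds_exp_angle s hx).mul
    ((((hasPds_angleGrad hn j).mul
      ((hasPds_const B x).add ((hasPds_exp_coord l x).const_mul (-1)))).const_mul s).add
      ((hasPds_exp_coord l x).const_mul (-(l * if j = 0 then 1 else 0))))
  have : pd i (pd j (barrier α l B s)) x = pd i (fun x => Real.exp (s * angle α x) *
      (s * (angleGrad j x * (B + -1 * Real.exp (l * x 0))) +
        -(l * if j = 0 then 1 else 0) * Real.exp (l * x 0))) x := by
    simp only [pd] at he ⊢
    rw [he.fderiv_eq]
  rw [this, h.pd_eq i]
  ring

theorem abs_mul_le_mul {a b c d : ℝ} (h1 : |a| ≤ c) (h2 : |b| ≤ d) : |a * b| ≤ c * d := by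
  rw [abs_mul]
  exact mul_le_mul h1 h2 (abs_nonneg _) ((abs_nonneg _).trans h1)

/-- Strict supersolution property of the barrier, for weights `|s| ≤ ν`. -/
theorem barrier_supersolution {Ω : Set Plane} {A : Plane → Matrix (Fin 2) (Fin 2) ℝ}
    {b : Plane → Plane} {c₀ M₁ M₂ : ℝ} (hA : Elliptic Ω A c₀ M₁) (hc₀ : 0 < c₀)
    (hb : ∀ x ∈ Ω, ‖b x‖ ≤ M₂) {l B μ ν ρ : ℝ} (hl : 0 < l) (hlc : M₂ + 1 ≤ c₀ * l)
    (hρ : 0 < ρ) (hν : ν ≤ 1)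
    (hνμ : ν * (4 * (M₁ * (2 * (1 / ρ ^ 2 * B) + 2 * (1 / ρ * (l * B)))) + 2 * (M₂ * (1 / ρ * B)))
      ≤ μ / 2) {α s : ℝ}
    (hs : |s| ≤ ν) {x : Plane} (hx : x ∈ Ω) (hα : 0 < rotFst α x) (hxρ : ρ ≤ ‖x‖)
    (hB : Real.exp (l * x 0) ≤ B) (hμ : μ ≤ l * Real.exp (l * x 0)) :
    Real.exp (s * angle α x) * (μ / 2) ≤ ellipticOp A b (barrier α l B s) x := by
  obtain ⟨hsym, h00, -, hent⟩ := hA.entries hc₀ hx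
  have hbi : ∀ i, |b x i| ≤ M₂ := fun i => (abs_coord_le_norm _ i).trans (hb x hx)
  set E := Real.exp (l * x 0) with hE
  have hEpos : 0 < E := Real.exp_pos _
  have hB0 : 0 < B := hEpos.trans_le hB
  have hEB : |E| ≤ B := by rwa [abs_of_pos hEpos]
  have hBE : |B + -1 * E| ≤ B := abs_le.2 ⟨by linarith, by linarith⟩
  have hG := fun j => abs_angleGrad_le hρ hxρ j
  have hH := fun j i => abs_angleHess_le hρ hxρ j i
  have hδ : ∀ i : Fin 2, |l * (if i = 0 then 1 else 0) * E| ≤ l * B := by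
    intro i
    split_ifs
    · simpa [abs_mul, abs_of_pos hl] using mul_le_mul_of_nonneg_left hEB hl.le
    · simp; positivity
  -- `T` collects the second-derivative terms that carry a factor `s`, and `R` below is the whole
  -- coefficient of `s` in `L` of the barrier. What remains is the `s`-free part `l E (a₀₀ l - b₀)`.
  set T : Fin 2 → Fin 2 → ℝ := fun i j => s * angleGrad i x * angleGrad j x * (B + -1 * E)
        + angleHess j i x * (B + -1 * E)
        - angleGrad j x * (l * (if i = 0 then 1 else 0) * E)
        - angleGrad i x * (l * (if j = 0 then 1 else 0) * E) with hT
  have hTb : ∀ i j, |T i j| ≤ 2 * (1 / ρ ^ 2 * B) + 2 * (1 / ρ * (l * B)) := by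
    intro i j
    have e1 : |s * angleGrad i x * angleGrad j x * (B + -1 * E)| ≤ 1 * (1 / ρ) * (1 / ρ) * B :=
      abs_mul_le_mul (abs_mul_le_mul (abs_mul_le_mul (hs.trans hν) (hG i)) (hG j)) hBE
    have e2 := abs_mul_le_mul (hH j i) hBE
    have e3 := abs_mul_le_mul (hG j) (hδ i)
    have e4 := abs_mul_le_mul (hG i) (hδ j)
    have e5 : 1 * (1 / ρ) * (1 / ρ) * B = 1 / ρ ^ 2 * B := by field_simp
    rw [e5] at e1
    rw [abs_le] at *
    simp only [hT]
    constructor <;> linarith [e1.1, e1.2, e2.1, e2.2, e3.1, e3.2, e4.1, e4.2]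
  set R := -(∑ i, ∑ j, A x i j * T i j) + ∑ i, b x i * (angleGrad i x * (B + -1 * E)) with hR
  have hRb : |R| ≤ 4 * (M₁ * (2 * (1 / ρ ^ 2 * B) + 2 * (1 / ρ * (l * B))))
      + 2 * (M₂ * (1 / ρ * B)) := by
    have e1 := fun i j => abs_le.1 (abs_mul_le_mul (hent i j) (hTb i j))
    have e2 := fun i => abs_le.1 (abs_mul_le_mul (hbi i) (abs_mul_le_mul (hG i) hBE))
    rw [abs_le]
    simp only [hR, Fin.sum_univ_two]
    constructor <;> linarith [(e1 0 0).1, (e1 0 0).2, (e1 0 1).1, (e1 0 1).2, (e1 1 0).1,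
      (e1 1 0).2, (e1 1 1).1, (e1 1 1).2, (e2 0).1, (e2 0).2, (e2 1).1, (e2 1).2]
  have key : ellipticOp A b (barrier α l B s) x = Real.exp (s * angle α x) *
      (A x 0 0 * l * (l * E) - b x 0 * (l * E) + s * R) := by
    simp only [ellipticOp, pd_barrier l B s hα, pd_pd_barrier l B s hα, hR, hT,
      Fin.sum_univ_two, ← hE]
    simp
    ring
  rw [key]
  refine mul_le_mul_of_nonneg_left ?_ (Real.exp_pos _).le
  have hsR : -(μ / 2) ≤ s * R := (abs_le.1 ((abs_mul_le_mul hs hRb).trans hνμ)).1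
  -- Here `a₀₀ l - b₀ ≥ c₀ l - M₂ ≥ 1`, so the main term is at least `l E ≥ μ`, of which `s R`
  -- consumes at most `μ / 2`.
  have h1 : 1 ≤ A x 0 0 * l - b x 0 := by
    nlinarith [(abs_le.1 (hbi 0)).2]
  nlinarith [mul_pos hl hEpos]


/-! ### Topology of the strip and the comparison argument -/

theorem continuous_polar : Continuous fun p : ℝ × ℝ => polar p.1 p.2 := by
  unfold polar
  refine (PiLp.continuous_toLp 2 _).comp (continuous_pi fun i => ?_)
  fin_cases i
  · exact continuous_fst.mul (Real.continuous_cos.comp continuous_snd)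
  · exact continuous_fst.mul (Real.continuous_sin.comp continuous_snd)

/-- The truncated strip is compact as the image of a rectangle under `r = r₁ + t (r₂ - r₁)`. -/
theorem exists_isMinOn_strip {T N : ℝ} {r₁ r₂ : ℝ → ℝ} (hTN : T ≤ N)
    (h₁ : ContinuousOn r₁ (Set.Icc T N)) (h₂ : ContinuousOn r₂ (Set.Icc T N))
    (hle : ∀ θ ∈ Set.Icc T N, r₁ θ ≤ r₂ θ) {g : ℝ × ℝ → ℝ}
    (hg : ContinuousOn g {p | p.2 ∈ Set.Icc T N ∧ p.1 ∈ Set.Icc (r₁ p.2) (r₂ p.2)}) :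
    ∃ p : ℝ × ℝ, (p.2 ∈ Set.Icc T N ∧ p.1 ∈ Set.Icc (r₁ p.2) (r₂ p.2)) ∧
      ∀ q : ℝ × ℝ, q.2 ∈ Set.Icc T N → q.1 ∈ Set.Icc (r₁ q.2) (r₂ q.2) → g p ≤ g q := by
  set S : Set (ℝ × ℝ) := {p | p.2 ∈ Set.Icc T N ∧ p.1 ∈ Set.Icc (r₁ p.2) (r₂ p.2)} with hS
  have hSeq : S = (fun p : ℝ × ℝ => (r₁ p.1 + p.2 * (r₂ p.1 - r₁ p.1), p.1)) ''
      (Set.Icc T N ×ˢ Set.Icc 0 1) := by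
    ext ⟨r, θ⟩
    simp only [hS, Set.mem_ofPred_eq, Set.mem_image, Prod.exists, Set.mem_prod, Prod.mk.injEq]
    constructor
    · rintro ⟨hθ, hr⟩
      rcases (hle θ hθ).eq_or_lt with h | h
      · exact ⟨θ, 0, ⟨hθ, by simp⟩, by linarith [hr.1, hr.2], rfl⟩
      · have h' := sub_pos.2 h
        refine ⟨θ, (r - r₁ θ) / (r₂ θ - r₁ θ), ⟨hθ, div_nonneg (by linarith [hr.1]) h'.le,
          (div_le_one h').2 (by linarith [hr.2])⟩, by field_simp; ring, rfl⟩
    · rintro ⟨θ', t, ⟨hθ, ht⟩, rfl, rfl⟩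
      have := sub_nonneg.2 (hle θ' hθ)
      exact ⟨hθ, by nlinarith [ht.1], by nlinarith [ht.2]⟩
  have hfst : ContinuousOn (Prod.fst : ℝ × ℝ → ℝ) (Set.Icc T N ×ˢ Set.Icc 0 1) :=
    continuous_fst.continuousOn
  have hm : Set.MapsTo (Prod.fst : ℝ × ℝ → ℝ) (Set.Icc T N ×ˢ Set.Icc (0 : ℝ) 1) (Set.Icc T N) :=
    fun p hp => hp.1
  have hc₁ := h₁.comp hfst hm
  have hc₂ := h₂.comp hfst hm
  have hcomp : IsCompact S := by
    rw [hSeq]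
    exact (isCompact_Icc.prod isCompact_Icc).image_of_continuousOn
      ((hc₁.add (continuous_snd.continuousOn.mul (hc₂.sub hc₁))).prodMk hfst)
  have hT : T ∈ Set.Icc T N := ⟨le_rfl, hTN⟩
  obtain ⟨p, hp, hmin⟩ := hcomp.exists_isMinOn ⟨(r₁ T, T), hT, le_rfl, hle T hT⟩ hg
  exact ⟨p, hp, fun q h1 h2 => hmin ⟨h1, h2⟩⟩

theorem eventually_mem_strip {θ₀ : ℝ} {r₁ r₂ : ℝ → ℝ} (h₁ : ContinuousOn r₁ (Set.Ici θ₀))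
    (h₂ : ContinuousOn r₂ (Set.Ici θ₀)) {r θ : ℝ} (hr : 0 < r) (hθ : θ₀ < θ) (hr₁ : r₁ θ < r)
    (hr₂ : r < r₂ θ) :
    ∀ᶠ y in 𝓝 (polar r θ), polar ‖y‖ (angle θ y) = y ∧
      r₁ (angle θ y) < ‖y‖ ∧ ‖y‖ < r₂ (angle θ y) := by
  have hpos : 0 < rotFst θ (polar r θ) := by rwa [rotFst_polar]
  have ha : ContinuousAt (angle θ) (polar r θ) := (contDiffAt_angle (n := 0) hpos).continuousAt
  have hn : ContinuousAt (fun y : Plane => ‖y‖) (polar r θ) := continuous_norm.continuousAt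
  have hnb : Set.Ici θ₀ ∈ 𝓝 (angle θ (polar r θ)) := by
    rw [angle_polar]; exact Ici_mem_nhds hθ
  have c₁ : ContinuousAt (fun y => r₁ (angle θ y)) (polar r θ) :=
    (h₁.continuousAt hnb).comp ha
  have c₂ : ContinuousAt (fun y => r₂ (angle θ y)) (polar r θ) :=
    (h₂.continuousAt hnb).comp ha
  filter_upwards [eventually_rotFst_pos hpos,
    c₁.eventually_lt hn (by rwa [angle_polar, norm_polar hr.le]),
    hn.eventually_lt c₂ (by rwa [angle_polar, norm_polar hr.le])] with y hy h1 h2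
  exact ⟨polar_norm_angle hy, h1, h2⟩

theorem domain_mem_nhds {θ₀ : ℝ} {r₁ r₂ : ℝ → ℝ} (h₁ : ContinuousOn r₁ (Set.Ici θ₀))
    (h₂ : ContinuousOn r₂ (Set.Ici θ₀)) (hpos : ∀ θ, θ₀ ≤ θ → 0 < r₁ θ) {x : Plane}
    (hx : x ∈ domain θ₀ r₁ r₂) : domain θ₀ r₁ r₂ ∈ 𝓝 x := by
  obtain ⟨r, θ, hθ, hr₁, hr₂, rfl⟩ := hx
  have hr := (hpos θ hθ.le).trans hr₁
  have hrot : 0 < rotFst θ (polar r θ) := by rwa [rotFst_polar]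
  filter_upwards [eventually_mem_strip h₁ h₂ hr hθ hr₁ hr₂,
    (contDiffAt_angle (n := 0) hrot).continuousAt.eventually_const_lt
      (by rwa [angle_polar] : θ₀ < angle θ (polar r θ))] with y hy hy'
  exact ⟨‖y‖, angle θ y, hy', hy.2.1, hy.2.2, hy.1.symm⟩

theorem ellipticOp_const (A : Plane → Matrix (Fin 2) (Fin 2) ℝ) (b : Plane → Plane) (m : ℝ)
    (x : Plane) : ellipticOp A b (fun _ => m) x = 0 := by
  have h : ∀ j, pd j (fun _ : Plane => m) = fun _ => 0 := by
    intro j; ext y; simp [pd]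
  have h' : ∀ j, pd j (fun _ : Plane => (0 : ℝ)) = fun _ => 0 := by
    intro j; ext y; simp [pd]
  simp [ellipticOp, h, h']

/-- One-sided comparison with the barrier, on the part `θ ≥ T` of the strip. -/
theorem comparison {θ₀ : ℝ} {r₁ r₂ : ℝ → ℝ}
    (hcont₁ : ContinuousOn r₁ (Set.Ici θ₀)) (hcont₂ : ContinuousOn r₂ (Set.Ici θ₀))
    {ρ R : ℝ} (hρ : 0 < ρ) (hρr : ∀ θ, θ₀ ≤ θ → ρ ≤ r₁ θ) (hr : ∀ θ, θ₀ ≤ θ → r₁ θ < r₂ θ)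
    (hR : ∀ θ, θ₀ ≤ θ → r₂ θ ≤ R)
    {A : Plane → Matrix (Fin 2) (Fin 2) ℝ} {b : Plane → Plane} {c₀ M₁ M₂ : ℝ}
    (hA : Elliptic (domain θ₀ r₁ r₂) A c₀ M₁) (hc₀ : 0 < c₀)
    (hb : ∀ x ∈ domain θ₀ r₁ r₂, ‖b x‖ ≤ M₂)
    {l B μ ν : ℝ} (hl : 0 < l) (hlc : M₂ + 1 ≤ c₀ * l) (hν0 : 0 < ν) (hν : ν ≤ 1)
    (hνμ : ν * (4 * (M₁ * (2 * (1 / ρ ^ 2 * B) + 2 * (1 / ρ * (l * B)))) + 2 * (M₂ * (1 / ρ * B)))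
      ≤ μ / 2) (hB : Real.exp (l * R) + 1 ≤ B) (hμ0 : 0 < μ) (hμ : μ ≤ l * Real.exp (l * -R))
    {u : Plane → ℝ} (hu : ContDiffOn ℝ 2 u (domain θ₀ r₁ r₂))
    (huc : ContinuousOn u (domainTilde θ₀ r₁ r₂))
    {T m F M η σ : ℝ} (hT : θ₀ ≤ T) (hη : 0 < η) (hσ : |σ| ≤ 1)
    (hm₁ : ∀ θ, T ≤ θ → |u (polar (r₁ θ) θ)| ≤ m) (hm₂ : ∀ θ, T ≤ θ → |u (polar (r₂ θ) θ)| ≤ m)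
    (hF0 : 0 ≤ F)
    (hF : ∀ θ r, T < θ → r₁ θ < r → r < r₂ θ → |ellipticOp A b u (polar r θ)| ≤ F)
    (hM : ∀ r, r₁ T ≤ r → r ≤ r₂ T → |u (polar r T)| ≤ M)
    (hgrow : ∀ᶠ θ in atTop, ∀ r, r₁ θ ≤ r → r ≤ r₂ θ →
      |u (polar r θ)| ≤ η * Real.exp (ν * θ))
    {r θ : ℝ} (hθ : T ≤ θ) (hr₁ : r₁ θ ≤ r) (hr₂ : r ≤ r₂ θ) :
    σ * u (polar r θ) ≤ m + (2 * F / μ + M * Real.exp (-ν * (θ - T)) + η * Real.exp (ν * θ)) * B := by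
  have hm0 : 0 ≤ m := (abs_nonneg _).trans (hm₁ T le_rfl)
  have hM0 : 0 ≤ M := (abs_nonneg _).trans (hM (r₁ T) le_rfl (hr T hT).le)
  have hσu : ∀ z : ℝ, σ * z ≤ |z| := fun z => (le_abs_self _).trans (by
    rw [abs_mul]; exact mul_le_of_le_one_left (abs_nonneg _) hσ)
  have hE : ∀ r θ, θ₀ ≤ θ → r₁ θ ≤ r → r ≤ r₂ θ → Real.exp (l * polar r θ 0) + 1 ≤ B ∧
      Real.exp (l * -R) ≤ Real.exp (l * polar r θ 0) := by
    intro r θ h0 h1 h2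
    have hn := abs_coord_le_norm (polar r θ) 0
    rw [norm_polar (hρ.le.trans ((hρr θ h0).trans h1))] at hn
    have hx := abs_le.1 (hn.trans (h2.trans (hR θ h0)))
    constructor
    · refine le_trans ?_ hB
      gcongr
      exact hx.2
    · gcongr
      exact hx.1
  set c : ℝ → ℝ := fun θ => 2 * F / μ + M * Real.exp (ν * T) * Real.exp (-ν * θ)
    + η * Real.exp (ν * θ) with hc
  have hceq : ∀ θ, 2 * F / μ + M * Real.exp (-ν * (θ - T)) + η * Real.exp (ν * θ) = c θ := by
    intro θ
    rw [hc]
    simp only [mul_assoc, ← Real.exp_add]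
    ring_nf
  have hc0 : ∀ θ, 0 ≤ c θ := fun θ => by rw [hc]; positivity
  -- `W` is the barrier sum minus `σ u`, as a function of `(r, θ)`; a negative minimum is shown to
  -- be impossible.
  set W : ℝ × ℝ → ℝ := fun p =>
    m + c p.2 * (B + -1 * Real.exp (l * polar p.1 p.2 0)) + (-σ) * u (polar p.1 p.2) with hW
  suffices h : 0 ≤ W (r, θ) by
    have h1 := (hE r θ (hT.trans hθ) hr₁ hr₂).1
    have h2 : c θ * (B + -1 * Real.exp (l * polar r θ 0)) ≤ c θ * B :=
      mul_le_mul_of_nonneg_left (by linarith [Real.exp_pos (l * polar r θ 0)]) (hc0 θ)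
    rw [hceq]
    simp only [hW] at h
    linarith
  by_contra! hneg
  -- Truncation at an `N` beyond `θ` where the `η`-term already dominates `u`.
  obtain ⟨N, hN, hNθ⟩ := (hgrow.and (eventually_gt_atTop θ)).exists
  have hsub : Set.Icc T N ⊆ Set.Ici θ₀ := fun t ht => hT.trans ht.1
  obtain ⟨⟨r', θ'⟩, ⟨⟨hθT, hθN⟩, hr1', hr2'⟩, hmin⟩ := exists_isMinOn_strip (g := W)
    (hθ.trans hNθ.le) (hcont₁.mono hsub) (hcont₂.mono hsub) (fun t ht => (hr t (hsub ht)).le) (by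
      have hp := continuous_polar
      have h1 : Continuous fun p : ℝ × ℝ =>
          m + c p.2 * (B + -1 * Real.exp (l * polar p.1 p.2 0)) := by
        have h2 : Continuous fun p : ℝ × ℝ => polar p.1 p.2 0 :=
          (contDiff_coord (n := 0) 0).continuous.comp hp
        fun_prop
      refine h1.continuousOn.add (continuousOn_const.mul (huc.comp hp.continuousOn ?_))
      exact fun p hq => ⟨p.1, p.2, hsub hq.1, hq.2.1, hq.2.2, rfl⟩)
  dsimp only at hθT hθN hr1' hr2'
  have hθ0 := hT.trans hθT
  have hWneg : W (r', θ') < 0 := (hmin (r, θ) ⟨hθ, hNθ.le⟩ ⟨hr₁, hr₂⟩).trans_lt hneg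
  have hh := hE r' θ' hθ0 hr1' hr2'
  -- Since `B - e^{l x₀} ≥ 1`, a bound `|u| ≤ m + k` with `k ≤ c θ'` contradicts `W < 0`. This
  -- excludes the four sides in turn: `k = M` at `T`, the `η`-term at `N`, and `k = 0` on the
  -- curves.
  have hlow : ∀ {k : ℝ}, |u (polar r' θ')| ≤ m + k → k ≤ c θ' → False := by
    intro k h1 h2
    have h3 : c θ' * 1 ≤ c θ' * (B + -1 * Real.exp (l * polar r' θ' 0)) :=
      mul_le_mul_of_nonneg_left (by linarith [hh.1]) (hc0 θ')
    simp only [hW] at hWneg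
    linarith [hσu (u (polar r' θ'))]
  have hTlt : T < θ' := by
    refine lt_of_le_of_ne hθT fun h => ?_
    subst h
    refine hlow (k := M) ((hM r' hr1' hr2').trans (by linarith)) ?_
    rw [← hceq]
    simp only [sub_self, mul_zero, Real.exp_zero, mul_one]
    have : 0 ≤ 2 * F / μ + η * Real.exp (ν * T) := by positivity
    linarith
  have hltN : θ' < N := by
    refine lt_of_le_of_ne hθN fun h => ?_
    subst h
    refine hlow (k := η * Real.exp (ν * θ')) ((hN r' hr1' hr2').trans (by linarith)) ?_
    simp only [hc]
    have : 0 ≤ 2 * F / μ + M * Real.exp (ν * T) * Real.exp (-ν * θ') := by positivity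
    linarith
  have hr1 : r₁ θ' < r' := lt_of_le_of_ne hr1' fun h => by
    subst h
    exact hlow (k := 0) (by simpa using hm₁ θ' hθT) (hc0 θ')
  have hr2 : r' < r₂ θ' := lt_of_le_of_ne hr2' fun h => by
    subst h
    exact hlow (k := 0) (by simpa using hm₂ θ' hθT) (hc0 θ')
  have hθ0' := hT.trans_lt hTlt
  have hr0 : 0 < r' := hρ.trans ((hρr θ' hθ0).trans_lt hr1)
  set x : Plane := polar r' θ' with hx
  have hxΩ : x ∈ domain θ₀ r₁ r₂ := ⟨r', θ', hθ0', hr1, hr2, rfl⟩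
  have hrot : 0 < rotFst θ' x := by rwa [hx, rotFst_polar]
  have hax : angle θ' x = θ' := angle_polar r' θ'
  have hanti := contDiffAt_barrier (n := 2) (α := θ') l B
  have hu2 : ContDiffAt ℝ 2 u x := hu.contDiffAt
    (domain_mem_nhds hcont₁ hcont₂ (fun t ht => hρ.trans_le (hρr t ht)) hxΩ)
  have hs : ∀ s, |s| ≤ ν → Real.exp (s * θ') * (μ / 2) ≤ ellipticOp A b (barrier θ' l B s) x := by
    intro s hs
    have := barrier_supersolution hA hc₀ hb hl hlc hρ hν hνμ hs hxΩ hrot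
      (by rw [hx, norm_polar hr0.le]; exact (hρr θ' hθ0).trans hr1') (by linarith [hh.1])
      (hμ.trans (mul_le_mul_of_nonneg_left hh.2 hl.le))
    rwa [hax] at this
  have d0 : ContDiffAt ℝ 2 (fun _ : Plane => m) x := contDiffAt_const
  have d1 := d0.add (contDiffAt_const (c := 2 * F / μ) |>.mul (hanti 0 hrot))
  have d2 := d1.add (contDiffAt_const (c := M * Real.exp (ν * T)) |>.mul (hanti (-ν) hrot))
  have d3 := d2.add (contDiffAt_const (c := η) |>.mul (hanti ν hrot))
  have d4 := d3.add (contDiffAt_const (c := -σ) |>.mul hu2)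
  -- Near `x`, `W` becomes a function on the plane through the branch of the angle centred at `θ'`.
  have hloc : ∀ y, polar ‖y‖ (angle θ' y) = y → m + 2 * F / μ * barrier θ' l B 0 y
      + M * Real.exp (ν * T) * barrier θ' l B (-ν) y + η * barrier θ' l B ν y + -σ * u y
      = W (‖y‖, angle θ' y) := by
    intro y hy
    simp only [hW, hc, hy, barrier, zero_mul, Real.exp_zero]
    ring
  have hmin' : IsLocalMin (fun y => m + 2 * F / μ * barrier θ' l B 0 y
      + M * Real.exp (ν * T) * barrier θ' l B (-ν) y + η * barrier θ' l B ν y + -σ * u y) x := by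
    have hca : ContinuousAt (angle θ') x := (contDiffAt_angle (n := 0) hrot).continuousAt
    have hnx : ‖x‖ = r' := norm_polar hr0.le θ'
    filter_upwards [eventually_mem_strip hcont₁ hcont₂ hr0 hθ0' hr1 hr2,
      hca.eventually_const_lt (by rwa [hax] : T < angle θ' x),
      hca.eventually_lt_const (by rwa [hax] : angle θ' x < N)] with y hy h1 h2
    rw [hloc y hy.1, hloc x (by rw [hax, hnx]), hax, hnx]
    exact hmin (‖y‖, angle θ' y) ⟨h1.le, h2.le⟩ ⟨hy.2.1.le, hy.2.2.le⟩
  have hle := ellipticOp_nonpos_of_isLocalMin hA hc₀ b hxΩ d4 hmin'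
  rw [ellipticOp_linear A b d3 hu2, ellipticOp_linear A b d2 (hanti ν hrot),
    ellipticOp_linear A b d1 (hanti (-ν) hrot), ellipticOp_linear A b d0 (hanti 0 hrot),
    ellipticOp_const] at hle
  -- The weight `2F/μ` contributes at least `F`, which cancels `σ Lu ≤ F`. The `η`-term is strictly
  -- positive and contradicts `LW ≤ 0` at the minimum.
  have e0 := mul_le_mul_of_nonneg_left (hs 0 (by simpa using hν0.le))
    (by positivity : 0 ≤ 2 * F / μ)
  have e1 := mul_le_mul_of_nonneg_left (hs (-ν) (by rw [abs_neg, abs_of_pos hν0]))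
    (by positivity : 0 ≤ M * Real.exp (ν * T))
  have e2 := mul_le_mul_of_nonneg_left (hs ν (by rw [abs_of_pos hν0])) hη.le
  have e3 : 0 ≤ M * Real.exp (ν * T) * (Real.exp (-ν * θ') * (μ / 2)) := by positivity
  have e4 : 0 < η * (Real.exp (ν * θ') * (μ / 2)) := by positivity
  have e5 : 2 * F / μ * (Real.exp (0 * θ') * (μ / 2)) = F := by
    simp; field_simp
  have e6 := (hσu (ellipticOp A b u x)).trans (hF θ' r' hTlt hr1 hr2)
  linarith

/-! ### Suprema, growth and bounds on the radii -/

theorem le_supAbs {S : Set Plane} {g : Plane → ℝ} (h : BoundedOn S g) {x : Plane} (hx : x ∈ S) :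
    |g x| ≤ supAbs S g := by
  obtain ⟨K, hK⟩ := h
  exact le_csSup ⟨K, by rintro _ ⟨y, hy, rfl⟩; exact hK y hy⟩ ⟨x, hx, rfl⟩

theorem supAbs_nonneg (S : Set Plane) (g : Plane → ℝ) : 0 ≤ supAbs S g :=
  Real.sSup_nonneg (by rintro _ ⟨y, -, rfl⟩; exact abs_nonneg _)

/-- The assumption `0 ≤ K` covers empty `S`, where `sSup` has the default value `0`. -/
theorem supAbs_le {S : Set Plane} {g : Plane → ℝ} {K : ℝ} (hK : 0 ≤ K) (h : ∀ x ∈ S, |g x| ≤ K) :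
    supAbs S g ≤ K :=
  Real.sSup_le (by rintro _ ⟨y, hy, rfl⟩; exact h y hy) hK

theorem BoundedOn.mono {S S' : Set Plane} {g : Plane → ℝ} (h : BoundedOn S g) (hs : S' ⊆ S) :
    BoundedOn S' g :=
  h.imp fun _ hK x hx => hK x (hs hx)

theorem BoundedOn.sub {S : Set Plane} {g g' : Plane → ℝ} (h : BoundedOn S g)
    (h' : BoundedOn S g') : BoundedOn S fun x => g x - g' x := by
  obtain ⟨K, hK⟩ := h
  obtain ⟨K', hK'⟩ := h'
  exact ⟨K + K', fun x hx => (abs_sub _ _).trans (add_le_add (hK x hx) (hK' x hx))⟩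

theorem boundedOn_crossSection {θ₀ : ℝ} {r₁ r₂ : ℝ → ℝ} {g : Plane → ℝ}
    (hg : ContinuousOn g (domainTilde θ₀ r₁ r₂)) {θ : ℝ} (hθ : θ₀ ≤ θ) :
    BoundedOn (crossSection r₁ r₂ θ) g := by
  have hc : IsCompact (crossSection r₁ r₂ θ) := by
    have : crossSection r₁ r₂ θ = (fun r => polar r θ) '' Set.Icc (r₁ θ) (r₂ θ) := by
      ext x
      simp [crossSection, and_assoc, eq_comm]
    rw [this]
    exact isCompact_Icc.image (continuous_polar.comp (by fun_prop : Continuous fun r => (r, θ)))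
  have hsub : crossSection r₁ r₂ θ ⊆ domainTilde θ₀ r₁ r₂ := by
    rintro x ⟨r, h1, h2, rfl⟩
    exact ⟨r, θ, hθ, h1, h2, rfl⟩
  obtain ⟨K, hK⟩ := hc.exists_bound_of_continuousOn (hg.mono hsub)
  exact ⟨K, hK⟩

theorem BelowExpGrowth.eventually_le {θ₀ : ℝ} {r₁ r₂ : ℝ → ℝ} {g : Plane → ℝ}
    (h : BelowExpGrowth r₁ r₂ g) (hg : ContinuousOn g (domainTilde θ₀ r₁ r₂)) {ν η : ℝ}
    (hν : 0 < ν) (hη : 0 < η) :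
    ∀ᶠ θ in atTop, ∀ r, r₁ θ ≤ r → r ≤ r₂ θ → |g (polar r θ)| ≤ η * Real.exp (ν * θ) := by
  filter_upwards [(h ν hν).eventually (gt_mem_nhds hη), eventually_ge_atTop θ₀] with θ h1 h2 r hr hr'
  refine (le_supAbs (boundedOn_crossSection hg h2) ⟨r, hr, hr', rfl⟩).trans ?_
  rw [Real.exp_neg, inv_mul_lt_iff₀ (Real.exp_pos _)] at h1
  linarith

theorem exists_le_of_tendsto {θ₀ a : ℝ} {f : ℝ → ℝ} (hf : ContinuousOn f (Set.Ici θ₀))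
    (hlim : Tendsto f atTop (𝓝 a)) : ∃ R, ∀ θ, θ₀ ≤ θ → f θ ≤ R := by
  obtain ⟨N, hN⟩ := eventually_atTop.1 (hlim.eventually (gt_mem_nhds (lt_add_one a)))
  obtain ⟨K, hK⟩ := (isCompact_Icc (a := θ₀) (b := N)).bddAbove_image
    (hf.mono Set.Icc_subset_Ici_self)
  refine ⟨max K (a + 1), fun θ hθ => ?_⟩
  rcases le_total θ N with h | h
  · exact le_max_of_le_left (hK ⟨θ, ⟨hθ, h⟩, rfl⟩)
  · exact le_max_of_le_right (hN θ h).le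

/-- Along `θ + k p` the values of `r₁` decrease, because `r₁(θ + p) < r₂(θ + p) < r₁(θ)`; hence they
stay above their limit. -/
theorem le_of_winding {θ₀ a p : ℝ} {r₁ r₂ : ℝ → ℝ} (hp : 0 < p)
    (hwind : ∀ θ, θ₀ ≤ θ → r₂ (θ + p) < r₁ θ ∧ r₁ θ < r₂ θ)
    (hlim : Tendsto r₁ atTop (𝓝 a)) {θ : ℝ} (hθ : θ₀ ≤ θ) : a ≤ r₁ θ := by
  have hle : ∀ k : ℕ, θ₀ ≤ θ + k * p := fun k => hθ.trans (by simp; positivity)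
  have hanti : Antitone fun k : ℕ => r₁ (θ + k * p) := by
    refine antitone_nat_of_succ_le fun k => ?_
    have h1 := (hwind _ (hle k)).1
    have h2 := (hwind _ (hle (k + 1))).2
    have e : θ + k * p + p = θ + (k + 1 : ℕ) * p := by push_cast; ring
    rw [e] at h1
    exact (h2.trans h1).le
  have ht : Tendsto (fun k : ℕ => θ + k * p) atTop atTop :=
    tendsto_atTop_add_const_left _ _ (tendsto_natCast_atTop_atTop.atTop_mul_const hp)
  simpa using hanti.le_of_tendsto (hlim.comp ht) 0


/-! ### Choice of constants and passage to the upper limit -/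

/-- The order matters: `l` beats the drift, `B` and `μ` are then read off from `|x₀| ≤ R`, and `ν`
comes last, small against all of them. -/
theorem exists_barrier_constants {c₀ M₁ M₂ ρ R : ℝ} (hc₀ : 0 < c₀) (hM₁ : 0 < M₁) (hM₂ : 0 ≤ M₂)
    (hρ : 0 < ρ) : ∃ l B μ ν : ℝ, 0 < l ∧ 0 < B ∧ 0 < μ ∧ 0 < ν ∧ M₂ + 1 ≤ c₀ * l ∧ ν ≤ 1 ∧
      ν * (4 * (M₁ * (2 * (1 / ρ ^ 2 * B) + 2 * (1 / ρ * (l * B)))) + 2 * (M₂ * (1 / ρ * B)))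
        ≤ μ / 2 ∧ Real.exp (l * R) + 1 ≤ B ∧ μ ≤ l * Real.exp (l * -R) := by
  set l := (M₂ + 1) / c₀ with hl
  have hl0 : 0 < l := by positivity
  set B := Real.exp (l * R) + 1 with hB
  have hB0 : 0 < B := by positivity
  set μ := l * Real.exp (l * -R) with hμ
  have hμ0 : 0 < μ := by positivity
  set K := 4 * (M₁ * (2 * (1 / ρ ^ 2 * B) + 2 * (1 / ρ * (l * B)))) + 2 * (M₂ * (1 / ρ * B)) with hK
  have hK0 : 0 < K := by positivity
  refine ⟨l, B, μ, min 1 (μ / 2 / K), hl0, hB0, hμ0, lt_min one_pos (by positivity), ?_,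
    min_le_left _ _, ?_, le_rfl, le_rfl⟩
  · rw [hl]; field_simp; rfl
  · exact (mul_le_mul_of_nonneg_right (min_le_right _ _) hK0.le).trans
      (div_mul_cancel₀ _ hK0.ne').le

/-- Restart the estimate at a late `T`, after which `a` and `k` are within `δ` of their upper
limits; the term in `g T` then decays. -/
theorem limsup_le_add_of_decay {g a k : ℝ → ℝ} {D K C ν T₀ : ℝ} (hν : 0 < ν) (hK : 0 ≤ K)
    (ha : ∀ θ, T₀ ≤ θ → |a θ| ≤ D) (hk : ∀ θ, T₀ ≤ θ → |k θ| ≤ D)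
    (hg : ∀ θ, 0 ≤ g θ)
    (h : ∀ T m F, T₀ ≤ T → (∀ θ, T ≤ θ → a θ ≤ m) → (∀ θ, T ≤ θ → k θ ≤ F) →
      ∀ θ, T ≤ θ → g θ ≤ m + K * F + C * g T * Real.exp (-ν * (θ - T))) :
    limsup g atTop ≤ limsup a atTop + K * limsup k atTop := by
  have hbdd : ∀ f : ℝ → ℝ, (∀ θ, T₀ ≤ θ → |f θ| ≤ D) → IsBoundedUnder (· ≤ ·) atTop f :=
    fun f hf => isBoundedUnder_of_eventually_le
      (eventually_atTop.2 ⟨T₀, fun θ hθ => (abs_le.1 (hf θ hθ)).2⟩)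
  refine le_of_forall_pos_le_add fun ε hε => ?_
  -- The total error is `δ` from `a`, `K δ` from `k` and `δ` from the decaying term.
  set δ := ε / (K + 2) with hδ
  have hδ0 : 0 < δ := by positivity
  have hev := (eventually_lt_of_limsup_lt (lt_add_of_pos_right (limsup a atTop) hδ0) (hbdd a ha)).and
    (eventually_lt_of_limsup_lt (lt_add_of_pos_right (limsup k atTop) hδ0) (hbdd k hk))
  obtain ⟨T, hT⟩ := eventually_atTop.1 hev
  have hbase := h (max T T₀) (limsup a atTop + δ) (limsup k atTop + δ) (le_max_right _ _)
    (fun θ hθ => (hT θ ((le_max_left _ _).trans hθ)).1.le)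
    (fun θ hθ => (hT θ ((le_max_left _ _).trans hθ)).2.le)
  have hdec : Tendsto (fun θ => C * g (max T T₀) * Real.exp (-ν * (θ - max T T₀))) atTop (𝓝 0) := by
    have h1 : Tendsto (fun θ => -ν * (θ - max T T₀)) atTop atBot :=
      (tendsto_atTop_add_const_right _ (-max T T₀) tendsto_id).const_mul_atTop_of_neg
        (neg_lt_zero.2 hν)
    simpa using (Real.tendsto_exp_atBot.comp h1).const_mul (C * g (max T T₀))
  refine limsup_le_of_le (isCoboundedUnder_le_of_le atTop (x := 0) hg) ?_
  filter_upwards [hdec.eventually (gt_mem_nhds hδ0), eventually_ge_atTop (max T T₀)] with θ h1 h2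
  have h3 := hbase θ h2
  have h4 : δ * (K + 2) = ε := by rw [hδ]; field_simp
  linarith

end Winding

end

/-! ### The main theorem -/

theorem theorem6p2
    (θ₀ : ℝ) (r₁ r₂ : ℝ → ℝ) (rStar : ℝ)
    (hcont₁ : ContinuousOn r₁ (Set.Ici θ₀)) (hcont₂ : ContinuousOn r₂ (Set.Ici θ₀))
    (hpos : ∀ θ, θ₀ ≤ θ → 0 < r₁ θ ∧ 0 < r₂ θ)
    (hwind : ∀ θ, θ₀ ≤ θ → r₂ (θ + 2 * Real.pi) < r₁ θ ∧ r₁ θ < r₂ θ)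
    (hrStar : 0 < rStar)
    (hlim₁ : Tendsto r₁ atTop (𝓝 rStar)) (hlim₂ : Tendsto r₂ atTop (𝓝 rStar))
    (c₀ M₁ M₂ : ℝ) (hc₀ : 0 < c₀) (hM₁ : 0 < M₁) (hM₂ : 0 ≤ M₂) :
    ∃ C ν K₁ : ℝ, 0 < C ∧ 0 < ν ∧ 0 < K₁ ∧
      ∀ (A : Winding.Plane → Matrix (Fin 2) (Fin 2) ℝ) (b : Winding.Plane → Winding.Plane)
        (u₁ u₂ f₁ f₂ : Winding.Plane → ℝ),
        Winding.Elliptic (Winding.domain θ₀ r₁ r₂) A c₀ M₁ →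
        (∀ x ∈ Winding.domain θ₀ r₁ r₂, ‖b x‖ ≤ M₂) →
        ContDiffOn ℝ 2 u₁ (Winding.domain θ₀ r₁ r₂) →
        ContinuousOn u₁ (Winding.domainTilde θ₀ r₁ r₂) →
        ContDiffOn ℝ 2 u₂ (Winding.domain θ₀ r₁ r₂) →
        ContinuousOn u₂ (Winding.domainTilde θ₀ r₁ r₂) →
        Winding.BoundedOn (Winding.domain θ₀ r₁ r₂) f₁ →
        Winding.BoundedOn (Winding.domain θ₀ r₁ r₂) f₂ →
        (∀ x ∈ Winding.domain θ₀ r₁ r₂, Winding.ellipticOp A b u₁ x = f₁ x) →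
        (∀ x ∈ Winding.domain θ₀ r₁ r₂, Winding.ellipticOp A b u₂ x = f₂ x) →
        Winding.BelowExpGrowth r₁ r₂ u₁ →
        Winding.BelowExpGrowth r₁ r₂ u₂ →
        Winding.BoundedOn (Winding.bdryCurves θ₀ r₁ r₂) u₁ →
        Winding.BoundedOn (Winding.bdryCurves θ₀ r₁ r₂) u₂ →
        (∀ θ, θ₀ ≤ θ →
          Winding.supAbs (Winding.crossSection r₁ r₂ θ) (fun x => u₁ x - u₂ x) ≤
            (1 + C) * Winding.supAbs (Winding.bdryCurves θ₀ r₁ r₂) (fun x => u₁ x - u₂ x)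
            + K₁ * (1 + C) * Winding.supAbs (Winding.domain θ₀ r₁ r₂) (fun x => f₁ x - f₂ x)
            + C * Winding.supAbs (Winding.crossSection r₁ r₂ θ₀) (fun x => u₁ x - u₂ x)
                * Real.exp (-(ν * (θ - θ₀)))) ∧
        limsup (fun θ : ℝ =>
            Winding.supAbs (Winding.crossSection r₁ r₂ θ) (fun x => u₁ x - u₂ x)) atTop ≤
          limsup (fun θ : ℝ =>
            Winding.supAbs (Winding.bdryCurves θ₀ r₁ r₂ ∩ Winding.crossSection r₁ r₂ θ)
              (fun x => u₁ x - u₂ x)) atTop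
          + K₁ * limsup (fun θ : ℝ =>
            Winding.supAbs (Winding.domain θ₀ r₁ r₂ ∩ Winding.crossSection r₁ r₂ θ)
              (fun x => f₁ x - f₂ x)) atTop := by
  obtain ⟨R, hR⟩ := Winding.exists_le_of_tendsto hcont₂ hlim₂
  have hρr : ∀ θ, θ₀ ≤ θ → rStar ≤ r₁ θ := fun θ hθ => Winding.le_of_winding Real.two_pi_pos hwind hlim₁ hθ
  have hr : ∀ θ, θ₀ ≤ θ → r₁ θ < r₂ θ := fun θ hθ => (hwind θ hθ).2
  obtain ⟨l, B, μ, ν, hl, hB0, hμ0, hν0, hlc, hν, hνμ, hB, hμ⟩ :=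
    Winding.exists_barrier_constants (R := R) hc₀ hM₁ hM₂ hrStar
  -- `C` is the upper bound `B` of the barrier factor, and `K₁` is `B` times the weight `2/μ` that
  -- absorbs the right-hand side.
  refine ⟨B, ν, 2 * B / μ, hB0, hν0, by positivity, ?_⟩
  intro A b u₁ u₂ f₁ f₂ hA hb hu₁ hu₁c hu₂ hu₂c hf₁ hf₂ hL₁ hL₂ hg₁ hg₂ hγ₁ hγ₂
  have hu := hu₁.sub hu₂
  have huc := hu₁c.sub hu₂c
  have hγ := hγ₁.sub hγ₂
  have hf := hf₁.sub hf₂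
  have hL : ∀ x ∈ Winding.domain θ₀ r₁ r₂,
      Winding.ellipticOp A b (fun x => u₁ x - u₂ x) x = f₁ x - f₂ x := by
    intro x hx
    have hn := Winding.domain_mem_nhds hcont₁ hcont₂ (fun t ht => (hpos t ht).1) hx
    have := Winding.ellipticOp_linear A b (hu₁.contDiffAt hn) (hu₂.contDiffAt hn) (-1)
    rw [hL₁ x hx, hL₂ x hx] at this
    simpa [← sub_eq_add_neg] using this
  have hgrow : ∀ η : ℝ, 0 < η → ∀ᶠ θ in atTop, ∀ r, r₁ θ ≤ r → r ≤ r₂ θ →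
      |u₁ (Winding.polar r θ) - u₂ (Winding.polar r θ)| ≤ η * Real.exp (ν * θ) := by
    intro η hη
    filter_upwards [hg₁.eventually_le hu₁c hν0 (half_pos hη),
      hg₂.eventually_le hu₂c hν0 (half_pos hη)] with θ h1 h2 r hr hr'
    have := (abs_sub (u₁ (Winding.polar r θ)) (u₂ (Winding.polar r θ))).trans (add_le_add (h1 r hr hr') (h2 r hr hr'))
    linarith
  have hcs := fun θ (hθ : θ₀ ≤ θ) => Winding.boundedOn_crossSection huc hθ
  have main : ∀ T m F, θ₀ ≤ T →
      (∀ θ, T ≤ θ → |u₁ (Winding.polar (r₁ θ) θ) - u₂ (Winding.polar (r₁ θ) θ)| ≤ m) →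
      (∀ θ, T ≤ θ → |u₁ (Winding.polar (r₂ θ) θ) - u₂ (Winding.polar (r₂ θ) θ)| ≤ m) → 0 ≤ F →
      (∀ θ r, T < θ → r₁ θ < r → r < r₂ θ → |f₁ (Winding.polar r θ) - f₂ (Winding.polar r θ)| ≤ F) →
      ∀ θ, T ≤ θ → Winding.supAbs (Winding.crossSection r₁ r₂ θ) (fun x => u₁ x - u₂ x) ≤
        m + 2 * B / μ * F + B * Winding.supAbs (Winding.crossSection r₁ r₂ T) (fun x => u₁ x - u₂ x)
          * Real.exp (-ν * (θ - T)) := by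
    intro T m F hT hm₁ hm₂ hF0 hF θ hθ
    set M := Winding.supAbs (Winding.crossSection r₁ r₂ T) (fun x => u₁ x - u₂ x) with hMdef
    have hM0 : 0 ≤ M := Winding.supAbs_nonneg _ _
    have hm0 : 0 ≤ m := (abs_nonneg _).trans (hm₁ T le_rfl)
    refine Winding.supAbs_le (by positivity) ?_
    rintro x ⟨r, hr1, hr2, rfl⟩
    -- Comparison with `σ = ±1` gives both signs of `u`, after letting `η` tend to `0` at a fixed
    -- point.
    have hone : ∀ σ : ℝ, |σ| ≤ 1 → σ * (u₁ (Winding.polar r θ) - u₂ (Winding.polar r θ)) ≤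
        m + 2 * B / μ * F + B * M * Real.exp (-ν * (θ - T)) := by
      intro σ hσ
      have hlimη : Tendsto (fun η : ℝ => m + (2 * F / μ + M * Real.exp (-ν * (θ - T))
          + η * Real.exp (ν * θ)) * B) (𝓝[>] 0)
          (𝓝 (m + (2 * F / μ + M * Real.exp (-ν * (θ - T)) + 0 * Real.exp (ν * θ)) * B)) :=
        (Continuous.tendsto (by fun_prop) 0).mono_left nhdsWithin_le_nhds
      have := ge_of_tendsto hlimη (b := σ * (u₁ (Winding.polar r θ) - u₂ (Winding.polar r θ))) (by
        filter_upwards [self_mem_nhdsWithin] with η hη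
        exact Winding.comparison hcont₁ hcont₂ hrStar hρr hr hR hA hc₀ hb hl hlc hν0 hν hνμ hB hμ0 hμ
          hu huc hT hη hσ hm₁ hm₂ hF0
          (fun θ r h1 h2 h3 => by
            rw [hL _ ⟨r, θ, hT.trans_lt h1, h2, h3, rfl⟩]
            exact hF θ r h1 h2 h3)
          (fun r h1 h2 => Winding.le_supAbs (hcs T hT) ⟨r, h1, h2, rfl⟩)
          (hgrow η hη) hθ hr1 hr2)
      refine this.trans (le_of_eq ?_)
      ring
    refine abs_le.2 ⟨?_, ?_⟩
    · linarith [hone (-1) (by simp)]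
    · linarith [hone 1 (by simp)]
  have hF0 := Winding.supAbs_nonneg (Winding.domain θ₀ r₁ r₂) (fun x => f₁ x - f₂ x)
  have hm0 := Winding.supAbs_nonneg (Winding.bdryCurves θ₀ r₁ r₂) (fun x => u₁ x - u₂ x)
  constructor
  · intro θ hθ
    have h := main θ₀ (Winding.supAbs (Winding.bdryCurves θ₀ r₁ r₂) (fun x => u₁ x - u₂ x))
      (Winding.supAbs (Winding.domain θ₀ r₁ r₂) (fun x => f₁ x - f₂ x)) le_rfl
      (fun t ht => Winding.le_supAbs hγ (Or.inl ⟨t, ht, rfl⟩))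
      (fun t ht => Winding.le_supAbs hγ (Or.inr ⟨t, ht, rfl⟩)) hF0
      (fun t r h1 h2 h3 => Winding.le_supAbs hf ⟨r, t, h1, h2, h3, rfl⟩) θ hθ
    refine h.trans ?_
    rw [neg_mul]
    -- `main` has factor `1` in place of `1 + C`; the difference is nonnegative.
    have h1 := mul_nonneg hB0.le hm0
    have h2 : 0 ≤ 2 * B / μ * B * Winding.supAbs (Winding.domain θ₀ r₁ r₂) (fun x => f₁ x - f₂ x) := by positivity
    linarith
  · have hbγ := fun θ => hγ.mono
      (Set.inter_subset_left (s := Winding.bdryCurves θ₀ r₁ r₂) (t := Winding.crossSection r₁ r₂ θ))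
    have hbf := fun θ => hf.mono
      (Set.inter_subset_left (s := Winding.domain θ₀ r₁ r₂) (t := Winding.crossSection r₁ r₂ θ))
    obtain ⟨D₁, hD₁⟩ := hγ
    obtain ⟨D₂, hD₂⟩ := hf
    set D := max 0 (max D₁ D₂) with hD
    have hD0 : 0 ≤ D := le_max_left _ _
    refine Winding.limsup_le_add_of_decay (D := D) (T₀ := θ₀ + 1) (C := B) hν0 (by positivity) ?_ ?_
      (fun θ => Winding.supAbs_nonneg _ _) ?_
    · intro θ _
      rw [abs_of_nonneg (Winding.supAbs_nonneg _ _)]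
      exact Winding.supAbs_le hD0 fun x hx => (hD₁ x hx.1).trans
        ((le_max_left _ _).trans (le_max_right _ _))
    · intro θ _
      rw [abs_of_nonneg (Winding.supAbs_nonneg _ _)]
      exact Winding.supAbs_le hD0 fun x hx => (hD₂ x hx.1).trans
        ((le_max_right _ _).trans (le_max_right _ _))
    · intro T m F hT hm hF
      have hT0 : θ₀ < T := by linarith
      refine main T m F hT0.le (fun t ht => ?_) (fun t ht => ?_)
        ((Winding.supAbs_nonneg _ _).trans (hF T le_rfl)) (fun t r h1 h2 h3 => ?_)
      · have ht0 := hT0.le.trans ht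
        exact (Winding.le_supAbs (hbγ t) ⟨Or.inl ⟨t, ht0, rfl⟩, r₁ t, le_rfl, (hr t ht0).le, rfl⟩).trans
          (hm t ht)
      · have ht0 := hT0.le.trans ht
        exact (Winding.le_supAbs (hbγ t) ⟨Or.inr ⟨t, ht0, rfl⟩, r₂ t, (hr t ht0).le, le_rfl, rfl⟩).trans
          (hm t ht)
      · exact (Winding.le_supAbs (hbf t) ⟨⟨r, t, hT0.trans h1, h2, h3, rfl⟩, r, h2.le, h3.le, rfl⟩).trans
          (hF t h1.le)
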